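/- **Setting.** There are $n$ items with unknown values $v_1,\dots,v_n\in\mathbb{R}$; we are given closed intervals $I_i=[\ell_i,r_i]$ with $v_i\in I_i$. Querying $I_i$ reveals $v_i$, replaces $I_i$ by $[v_i,v_i]$, and costs $1$ (uniform query costs). The error threshold is $\delta=0$: the goal is a permutation $\pi$ of $\{1,\dots,n\}$ such that $v_i\le v_j$ whenever $\pi(i)<\pi(j)$. A set $Q$ of items *proves an ordering* if there is a permutation $\pi$ such that $u_i\le u_j$ whenever $\pi(i)<\pi(j)$, for all $u\in\mathbb{R}^n$ with $u_i\in[\ell_i,r_i]$ for all $i$ and $u_i=v_i$ for $i\in Q$. An *offline optimum query set* is such a $Q$ of minimum size. Below, $I_i=[\ell_i,r_i]$ always denotes the current interval (that is, $[v_i,v_i]$ once $i$ has been queried), and $I_i\supset[a,b]$ means $\ell_i<a$ and $b<r_i$. Two distinct items $i,j$ are *dependent* if $r_i>\ell_j$ and $r_j>\ell_i$; the *dependency graph* has the items as vertices and the dependent pairs as edges. **Algorithm.** 1. *Preprocessing.* While there are $i,j$ with $I_i\supset[\ell_j,r_j]$, or with $I_i\supset[v_j,v_j]$ and $j$ already queried,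 query such an $I_i$. 2. While the dependency graph has an edge, do the following. * If some component consists of a single edge $ij$, pick one of its endpoints (deterministically, by any rule), say $i$, and query $I_i$; if then $I_j\supset[v_i,v_i]$, also query $I_j$. * Otherwise let $x$ be a non-isolated vertex with minimum $r_x$, let $y$ be a neighbor of $x$ with minimum $r_y$, and let $z$ be another neighbor of $x$ (or, if $y$ is the only neighbor of $x$, another neighbor of $y$) with minimum $r_z$. Query $I_y$. If then $I_x\supset[v_y,v_y]$, or $x$ and $z$ are dependent, query $I_x$ and $I_z$. * Finally, while there is $I_i\supset[v_j,v_j]$ for some queried $j$, query such an $I_i$. All remaining choices (which interval to query in a loop, which single-edge component to treat, ties) are made arbitrarily. **Theorem.** There is an absolute constant $C>0$ such that the following holds for every integer $k\ge 1$ and every instance for which, at the end of the preprocessing, every component of the dependency graph that contains an edge has at least $k$ vertices. However its choices are made, the algorithm terminates, the set of queries it has made proves an ordering, and the number of these queries is at most $$\left(\frac32+\frac{C}{k}\right)\cdot|Q|,$$ where $Q$ is an offline optimum query set. In other words, the deterministic algorithm has query-competitive ratio $3/2+O(1/k)$ on these instances. -/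

import Mathlib

/-- An instance of sorting under uncertainty: item `i` has an uncertainty interval `[lo i, hi i]`
and an actual value `val i` in it, which is revealed when the interval is queried.
`δ` is the error threshold. Every query has unit cost. -/
structure SortingInstance (n : ℕ) where
  lo : Fin n → ℝ
  hi : Fin n → ℝ
  val : Fin n → ℝ
  δ : ℝ
  δ_nonneg : 0 ≤ δ
  lo_le_val : ∀ i, lo i ≤ val i
  val_le_hi : ∀ i, val i ≤ hi i

namespace SortingInstance

variable {n : ℕ} (P : SortingInstance n)

/-! ### Offline optimum -/

/-- Querying the set `Q` suffices to prove an ordering: some permutation is a correct solution for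
all values that are compatible with the intervals and with the answers to the queries in `Q`. -/
def ProvesOrder (Q : Finset (Fin n)) : Prop :=
  ∃ π : Equiv.Perm (Fin n), ∀ u : Fin n → ℝ,
    (∀ i, u i ∈ Set.Icc (P.lo i) (P.hi i)) → (∀ i ∈ Q, u i = P.val i) →
      ∀ i j, π i < π j → u i ≤ u j + P.δ

/-- An offline optimum query set (for unit query costs). -/
def IsOptimalQuerySet (Q : Finset (Fin n)) : Prop :=
  P.ProvesOrder Q ∧ ∀ Q' : Finset (Fin n), P.ProvesOrder Q' → Q.card ≤ Q'.card

theorem provesOrder_univ : P.ProvesOrder Finset.univ := by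
  refine ⟨(Tuple.sort P.val).symm, fun u _ hu i j hij => ?_⟩
  have h := Tuple.monotone_sort P.val hij.le
  simp only [Function.comp_apply, Equiv.apply_symm_apply] at h
  rw [hu i (Finset.mem_univ i), hu j (Finset.mem_univ j)]
  linarith [P.δ_nonneg]

theorem exists_isOptimalQuerySet : ∃ Q : Finset (Fin n), P.IsOptimalQuerySet Q := by
  classical
  obtain ⟨Q, hQ, hmin⟩ := Finset.exists_min_image
    ((Finset.univ : Finset (Finset (Fin n))).filter P.ProvesOrder) Finset.card
    ⟨Finset.univ, by simp [P.provesOrder_univ]⟩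
  exact ⟨Q, (Finset.mem_filter.1 hQ).2, fun Q' hQ' => hmin Q' (by simp [hQ'])⟩

/-! ### Intervals and dependency graph after some queries

A list `L : List (Fin n)` records all queries made so far, in order. -/

/-- Left end of the current interval `i`: a queried interval is replaced by `[val i, val i]`. -/
noncomputable def curLo (L : List (Fin n)) (i : Fin n) : ℝ :=
  if i ∈ L then P.val i else P.lo i

/-- Right end of the current interval `i`. -/
noncomputable def curHi (L : List (Fin n)) (i : Fin n) : ℝ :=
  if i ∈ L then P.val i else P.hi i

/-- The current interval `i` contains `[a, b]` with both inequalities strict. -/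
def StrictlyContains (L : List (Fin n)) (i : Fin n) (a b : ℝ) : Prop :=
  P.curLo L i < a ∧ b < P.curHi L i

/-- The graph of the dependency relation between the current intervals. -/
def depGraph (L : List (Fin n)) : SimpleGraph (Fin n) where
  Adj i j := i ≠ j ∧ P.curHi L i - P.curLo L j > P.δ ∧ P.curHi L j - P.curLo L i > P.δ
  symm := ⟨fun _ _ h => ⟨h.1.symm, h.2.2, h.2.1⟩⟩
  loopless := ⟨fun _ h => h.1 rfl⟩

/-! ### The algorithm -/

/-- The current interval `i` strictly contains `[v_j - δ, v_j + δ]` for some queried `j`. -/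
def CleanupGuard (L : List (Fin n)) (i : Fin n) : Prop :=
  ∃ j ∈ L, P.StrictlyContains L i (P.val j - P.δ) (P.val j + P.δ)

/-- The condition under which interval `i` is queried in the preprocessing loop. -/
def PreprocessGuard (L : List (Fin n)) (i : Fin n) : Prop :=
  (∃ j, P.StrictlyContains L i (P.curLo L j - P.δ) (P.curHi L j + P.δ)) ∨ P.CleanupGuard L i

/-- `{i, j}` is a connected component consisting of a single edge. -/
def IsEdgeComponent (L : List (Fin n)) (i j : Fin n) : Prop :=
  (P.depGraph L).neighborSet i = {j} ∧ (P.depGraph L).neighborSet j = {i}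

/-- `x` has minimum right end among the vertices in `S`. -/
def IsMinRight (L : List (Fin n)) (S : Set (Fin n)) (x : Fin n) : Prop :=
  x ∈ S ∧ ∀ u ∈ S, P.curHi L x ≤ P.curHi L u

/-- A valid choice of `x`, `y`, `z`: `x` is a non-isolated vertex with minimum right end, `y` is a
neighbor of `x` with minimum right end, and `z` is another neighbor of `x` (or of `y`, if `y` is the
only neighbor of `x`) with minimum right end. Ties are broken arbitrarily. -/
def IsTripleChoice (L : List (Fin n)) (x y z : Fin n) : Prop :=
  P.IsMinRight L {u | ∃ w, (P.depGraph L).Adj u w} x ∧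
  P.IsMinRight L ((P.depGraph L).neighborSet x) y ∧
  (((P.depGraph L).neighborSet x ≠ {y} ∧
      P.IsMinRight L ((P.depGraph L).neighborSet x \ {y}) z) ∨
    ((P.depGraph L).neighborSet x = {y} ∧
      P.IsMinRight L ((P.depGraph L).neighborSet y \ {x}) z))

/-- The body of the main loop up to (and excluding) its inner loop. In the first two cases, a
component is an edge and one of its endpoints `i` is picked deterministically (either endpoint is
allowed, and in any way); in the last two cases no component is an edge. -/
inductive Body : List (Fin n) → List (Fin n) → Prop
  | edge_one (L : List (Fin n)) (i j : Fin n) (hij : P.IsEdgeComponent L i j)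
      (h : ¬ P.StrictlyContains (L ++ [i]) j (P.val i - P.δ) (P.val i + P.δ)) :
      Body L (L ++ [i])
  | edge_two (L : List (Fin n)) (i j : Fin n) (hij : P.IsEdgeComponent L i j)
      (h : P.StrictlyContains (L ++ [i]) j (P.val i - P.δ) (P.val i + P.δ)) :
      Body L (L ++ [i, j])
  | triple_one (L : List (Fin n)) (x y z : Fin n) (hno : ∀ i j, ¬ P.IsEdgeComponent L i j)
      (hxyz : P.IsTripleChoice L x y z)
      (h : ¬ (P.StrictlyContains (L ++ [y]) x (P.val y - P.δ) (P.val y + P.δ) ∨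
        (P.depGraph (L ++ [y])).Adj x z)) :
      Body L (L ++ [y])
  | triple_three (L : List (Fin n)) (x y z : Fin n) (hno : ∀ i j, ¬ P.IsEdgeComponent L i j)
      (hxyz : P.IsTripleChoice L x y z)
      (h : P.StrictlyContains (L ++ [y]) x (P.val y - P.δ) (P.val y + P.δ) ∨
        (P.depGraph (L ++ [y])).Adj x z) :
      Body L (L ++ [y, x, z])

/-- Control states: the preprocessing loop, the head of the main loop, the inner loop at the end of
the main loop's body, and termination. -/
inductive Phase
  | preprocessing
  | main
  | cleanup
  | done

/-- One step of the algorithm on (control state, list of queries made so far). -/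
inductive Step : Phase × List (Fin n) → Phase × List (Fin n) → Prop
  | preprocess_query (L : List (Fin n)) (i : Fin n) (h : P.PreprocessGuard L i) :
      Step (Phase.preprocessing, L) (Phase.preprocessing, L ++ [i])
  | preprocess_exit (L : List (Fin n)) (h : ∀ i, ¬ P.PreprocessGuard L i) :
      Step (Phase.preprocessing, L) (Phase.main, L)
  | main_body (L L' : List (Fin n)) (hdep : ∃ i j, (P.depGraph L).Adj i j) (h : P.Body L L') :
      Step (Phase.main, L) (Phase.cleanup, L')
  | main_exit (L : List (Fin n)) (hdep : ¬ ∃ i j, (P.depGraph L).Adj i j) :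
      Step (Phase.main, L) (Phase.done, L)
  | cleanup_query (L : List (Fin n)) (i : Fin n) (h : P.CleanupGuard L i) :
      Step (Phase.cleanup, L) (Phase.cleanup, L ++ [i])
  | cleanup_exit (L : List (Fin n)) (h : ∀ i, ¬ P.CleanupGuard L i) :
      Step (Phase.cleanup, L) (Phase.main, L)

/-- `s` occurs in some execution of the algorithm. -/
def Reachable (s : Phase × List (Fin n)) : Prop :=
  Relation.ReflTransGen P.Step (Phase.preprocessing, []) s

/-- `L` is the list of queries made when the preprocessing loop finishes (in some execution). -/
def PreprocessingResult (L : List (Fin n)) : Prop :=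
  P.Reachable (Phase.preprocessing, L) ∧ ∀ i, ¬ P.PreprocessGuard L i

/-- After preprocessing, every component of the dependency graph that has an edge contains at least
`k` vertices. (Isolated vertices, such as the already queried intervals, need no further query.) -/
def LargeComponentsAfterPreprocessing (k : ℕ) : Prop :=
  ∀ L, P.PreprocessingResult L → ∀ c : (P.depGraph L).ConnectedComponent,
    c.supp.Nontrivial → k ≤ c.supp.ncard

/-- On the instance `P`, the algorithm, however its choices are resolved, always terminates and
never gets stuck, the queries it has made prove an ordering, and their number is at most `α` times
the size of an offline optimum query set. -/
def AlgorithmCompetitive (α : ℝ) : Prop :=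
  (∀ f : ℕ → Phase × List (Fin n), f 0 = (Phase.preprocessing, []) →
    ¬ ∀ m, P.Step (f m) (f (m + 1))) ∧
  ∀ (ph : Phase) (L : List (Fin n)), P.Reachable (ph, L) → (∀ t, ¬ P.Step (ph, L) t) →
    ph = Phase.done ∧ P.ProvesOrder L.toFinset ∧
      ∀ Q : Finset (Fin n), P.IsOptimalQuerySet Q → (L.length : ℝ) ≤ α * (Q.card : ℝ)

end SortingInstance

/-!
Every set `Q` that proves an ordering is a vertex cover of the dependency graph and contains each
item whose interval has the value of another item in its interior (`ProvesOrder.mem_or_mem_of_lt`,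
`ProvesOrder.mem_of_val_mem_Ioo`). So the queries of the preprocessing and of the inner loops all
belong to `Q`, and a pass through the main loop makes three queries inside a triple that meets `Q`
twice, or one inside a pair that meets `Q`, or else it removes a single-edge component, which
meets `Q`, with at most two queries. Only this last case is worse than `3 / 2`, by `1 / 2`, so what
has to be bounded is the number of single-edge components that ever show up.

After the preprocessing no active interval strictly contains another one. For a set `U` of such
intervals, the components of the union of the open intervals are counted by their right ends,
`componentEnds U`. Removing the interval with the smallest right end of its component creates no
new component (`componentEnds_erase_subset`), and the triples consist of the three intervals of a
component with the smallest right ends. Removing any other interval creates at most one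
(`card_componentEnds_erase_le`); this happens in the inner loops only, whose queries are all in `Q`
and leave `1 / 2` to spare. Hence `2 * queries + components ≤ 3 * |Q \ U| + m` is invariant
(`Balanced`), where `m` is the number of components after the preprocessing.

Finally `k * m` is at most the number of non-isolated items after the preprocessing
(`mul_card_componentEnds_le`), and since the dependency graph is then claw-free, every item of `Q`
has at most two neighbors outside `Q`, so that this number is at most `3 * |Q|`
(`card_nonisolated_le`). Altogether there are at most `(3 / 2 + 3 / (2 * k)) * |Q|` queries.
-/

namespace SortingInstance

variable {n : ℕ} {P : SortingInstance n} {L : List (Fin n)} {Q U : Finset (Fin n)}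

/-! ### Current intervals and dependency -/

theorem curLo_le_val (L : List (Fin n)) (i : Fin n) : P.curLo L i ≤ P.val i := by
  unfold curLo
  split_ifs
  exacts [le_rfl, P.lo_le_val i]

theorem val_le_curHi (L : List (Fin n)) (i : Fin n) : P.val i ≤ P.curHi L i := by
  unfold curHi
  split_ifs
  exacts [le_rfl, P.val_le_hi i]

theorem curLo_of_mem {i : Fin n} (h : i ∈ L) : P.curLo L i = P.val i := if_pos h

theorem curHi_of_mem {i : Fin n} (h : i ∈ L) : P.curHi L i = P.val i := if_pos h

theorem curLo_of_notMem {i : Fin n} (h : i ∉ L) : P.curLo L i = P.lo i := if_neg h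

theorem curHi_of_notMem {i : Fin n} (h : i ∉ L) : P.curHi L i = P.hi i := if_neg h

theorem curLo_le_curLo_append (L q : List (Fin n)) (i : Fin n) :
    P.curLo L i ≤ P.curLo (L ++ q) i := by
  by_cases h : i ∈ L
  · rw [curLo_of_mem h, curLo_of_mem (List.mem_append_left q h)]
  · rw [curLo_of_notMem h]
    unfold curLo
    split_ifs
    exacts [P.lo_le_val i, le_rfl]

theorem curHi_append_le_curHi (L q : List (Fin n)) (i : Fin n) :
    P.curHi (L ++ q) i ≤ P.curHi L i := by
  by_cases h : i ∈ L
  · rw [curHi_of_mem h, curHi_of_mem (List.mem_append_left q h)]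
  · rw [curHi_of_notMem h]
    unfold curHi
    split_ifs
    exacts [P.val_le_hi i, le_rfl]

theorem depGraph_adj_iff (hδ : P.δ = 0) {i j : Fin n} :
    (P.depGraph L).Adj i j ↔
      i ≠ j ∧ P.curLo L j < P.curHi L i ∧ P.curLo L i < P.curHi L j := by
  simp [depGraph, hδ]

theorem depGraph_adj_iff_of_notMem (hδ : P.δ = 0) {i j : Fin n} (hi : i ∉ L) (hj : j ∉ L) :
    (P.depGraph L).Adj i j ↔ i ≠ j ∧ P.lo j < P.hi i ∧ P.lo i < P.hi j := by
  rw [depGraph_adj_iff hδ, curLo_of_notMem hi, curLo_of_notMem hj, curHi_of_notMem hi,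
    curHi_of_notMem hj]

/-- Queries only shrink intervals, so they never create dependencies. -/
theorem adj_of_adj_append (hδ : P.δ = 0) {q : List (Fin n)} {i j : Fin n}
    (h : (P.depGraph (L ++ q)).Adj i j) : (P.depGraph L).Adj i j := by
  rw [depGraph_adj_iff hδ] at h ⊢
  have := P.curLo_le_curLo_append L q i
  have := P.curLo_le_curLo_append L q j
  have := P.curHi_append_le_curHi L q i
  have := P.curHi_append_le_curHi L q j
  exact ⟨h.1, by linarith [h.2.1], by linarith [h.2.2]⟩

theorem strictlyContains_of_adj (hδ : P.δ = 0) {i j : Fin n} (h : (P.depGraph L).Adj i j)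
    (hj : j ∈ L) : P.StrictlyContains L i (P.val j - P.δ) (P.val j + P.δ) := by
  rw [depGraph_adj_iff hδ, curLo_of_mem hj, curHi_of_mem hj] at h
  simpa [StrictlyContains, hδ] using ⟨h.2.2, h.2.1⟩

theorem cleanupGuard_iff (hδ : P.δ = 0) {i : Fin n} :
    P.CleanupGuard L i ↔ ∃ j ∈ L, P.curLo L i < P.val j ∧ P.val j < P.curHi L i := by
  simp [CleanupGuard, StrictlyContains, hδ]

theorem CleanupGuard.notMem (hδ : P.δ = 0) {i : Fin n} (h : P.CleanupGuard L i) : i ∉ L := by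
  intro hi
  obtain ⟨j, -, h1, h2⟩ := (cleanupGuard_iff hδ).1 h
  rw [curLo_of_mem hi] at h1
  rw [curHi_of_mem hi] at h2
  exact lt_asymm h1 h2

/-- Once the cleanup is finished, queried items are isolated. -/
theorem notMem_of_adj (hδ : P.δ = 0) (hL : ∀ i, ¬ P.CleanupGuard L i) {i j : Fin n}
    (h : (P.depGraph L).Adj i j) : i ∉ L :=
  fun hi => hL j ⟨i, hi, strictlyContains_of_adj hδ h.symm hi⟩

theorem PreprocessGuard.exists_val_mem (hδ : P.δ = 0) {i : Fin n} (h : P.PreprocessGuard L i) :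
    i ∉ L ∧ ∃ j, j ≠ i ∧ P.lo i < P.val j ∧ P.val j < P.hi i := by
  rcases h with ⟨j, h1, h2⟩ | h
  · rw [hδ, sub_zero] at h1
    rw [hδ, add_zero] at h2
    have := P.curLo_le_val L j
    have := P.val_le_curHi L j
    have hi : i ∉ L := by
      intro hi
      rw [curLo_of_mem hi] at h1
      rw [curHi_of_mem hi] at h2
      linarith
    refine ⟨hi, j, ?_, ?_, ?_⟩
    · rintro rfl
      exact lt_irrefl _ h1
    · rw [curLo_of_notMem hi] at h1
      linarith
    · rw [curHi_of_notMem hi] at h2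
      linarith
  · have hi := h.notMem hδ
    obtain ⟨j, hj, h1, h2⟩ := (cleanupGuard_iff hδ).1 h
    rw [curLo_of_notMem hi] at h1
    rw [curHi_of_notMem hi] at h2
    exact ⟨hi, j, fun e => hi (e ▸ hj), h1, h2⟩

/-! ### Query sets that prove an ordering -/

/-- An item with the value of another item in the interior of its interval has to be queried. -/
theorem ProvesOrder.mem_of_val_mem_Ioo (hδ : P.δ = 0) (hQ : P.ProvesOrder Q) {i j : Fin n}
    (hij : j ≠ i) (h1 : P.lo i < P.val j) (h2 : P.val j < P.hi i) : i ∈ Q := by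
  by_contra hi
  obtain ⟨π, hπ⟩ := hQ
  have key : ∀ t ∈ Set.Icc (P.lo i) (P.hi i), (π i < π j → t ≤ P.val j) ∧
      (π j < π i → P.val j ≤ t) := by
    intro t ht
    have := hπ (Function.update P.val i t) (fun a => by
      by_cases ha : a = i
      · subst ha
        simpa using ht
      · simpa [ha] using ⟨P.lo_le_val a, P.val_le_hi a⟩) (fun a ha => by
      have : a ≠ i := fun e => hi (e ▸ ha)
      simp [this])
    exact ⟨fun h => by simpa [hδ, hij] using this i j h,
      fun h => by simpa [hδ, hij] using this j i h⟩
  rcases lt_or_gt_of_ne (π.injective.ne hij) with h | h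
  · exact absurd ((key (P.lo i) ⟨le_rfl, by linarith⟩).2 h) (not_le.2 h1)
  · exact absurd ((key (P.hi i) ⟨by linarith, le_rfl⟩).1 h) (not_le.2 h2)

/-- A query set that proves an ordering is a vertex cover of the dependency graph. -/
theorem ProvesOrder.mem_or_mem_of_lt (hδ : P.δ = 0) (hQ : P.ProvesOrder Q) {i j : Fin n}
    (hij : i ≠ j) (h1 : P.lo j < P.hi i) (h2 : P.lo i < P.hi j) : i ∈ Q ∨ j ∈ Q := by
  by_contra! hn
  obtain ⟨π, hπ⟩ := hQ
  -- Of two dependent items outside `Q`, the first in the order can be given its right end and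
  -- the second its left end.
  have key : ∀ a b : Fin n, a ≠ b → a ∉ Q → b ∉ Q → P.lo b < P.hi a → ¬ π a < π b := by
    intro a b hab ha hb hlt hπab
    have := hπ (Function.update (Function.update P.val a (P.hi a)) b (P.lo b)) (fun c => by
      by_cases hcb : c = b
      · subst hcb
        simpa using (P.lo_le_val c).trans (P.val_le_hi c)
      · by_cases hca : c = a
        · subst hca
          simpa [hcb] using (P.lo_le_val c).trans (P.val_le_hi c)
        · simpa [hcb, hca] using ⟨P.lo_le_val c, P.val_le_hi c⟩) (fun c hc => by
      have h1 : c ≠ a := fun e => ha (e ▸ hc)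
      have h2 : c ≠ b := fun e => hb (e ▸ hc)
      simp [h1, h2]) a b hπab
    simp [hab, hδ] at this
    linarith
  rcases lt_or_gt_of_ne (π.injective.ne hij) with h | h
  · exact key i j hij hn.1 hn.2 h1 h
  · exact key j i hij.symm hn.2 hn.1 h2 h

theorem ProvesOrder.mem_or_mem_of_adj (hδ : P.δ = 0) (hQ : P.ProvesOrder Q) {i j : Fin n}
    (h : (P.depGraph L).Adj i j) : i ∈ Q ∨ j ∈ Q := by
  have h0 : (P.depGraph []).Adj i j := adj_of_adj_append (q := L) hδ h
  rw [depGraph_adj_iff_of_notMem hδ List.not_mem_nil List.not_mem_nil] at h0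
  exact hQ.mem_or_mem_of_lt hδ h0.1 h0.2.1 h0.2.2

/-- Without dependencies, sorting the current intervals by their midpoints is correct. -/
theorem provesOrder_of_forall_not_adj (hδ : P.δ = 0) (h : ¬ ∃ i j, (P.depGraph L).Adj i j) :
    P.ProvesOrder L.toFinset := by
  refine ⟨(Tuple.sort fun i => P.curLo L i + P.curHi L i).symm, fun u hu huL i j hij => ?_⟩
  have hle := Tuple.monotone_sort (fun i => P.curLo L i + P.curHi L i) hij.le
  simp only [Function.comp_apply, Equiv.apply_symm_apply] at hle
  have hmem : ∀ a, P.curLo L a ≤ u a ∧ u a ≤ P.curHi L a := by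
    intro a
    by_cases ha : a ∈ L
    · rw [curLo_of_mem ha, curHi_of_mem ha, huL a (List.mem_toFinset.2 ha)]
      exact ⟨le_rfl, le_rfl⟩
    · rw [curLo_of_notMem ha, curHi_of_notMem ha]
      exact hu a
  have hne : i ≠ j := by
    rintro rfl
    exact lt_irrefl _ hij
  have hnot : ¬ (P.depGraph L).Adj i j := fun e => h ⟨i, j, e⟩
  rw [depGraph_adj_iff hδ] at hnot
  have := hmem i
  have := hmem j
  by_contra! hlt
  rw [hδ] at hlt
  exact hnot ⟨hne, by linarith, by linarith⟩

/-! ### Components of a family of intervals -/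

/-- The right ends of the components of the union of the open intervals `(lo i, hi i)`, `i ∈ U`:
those right ends of intervals that are not inside another of these intervals. -/
noncomputable def componentEnds (P : SortingInstance n) (U : Finset (Fin n)) : Finset ℝ :=
  (U.filter fun i => ∀ j ∈ U, ¬ (P.lo j < P.hi i ∧ P.hi i < P.hi j)).image P.hi

/-- The intervals of `U` are nonempty and none strictly contains another one. -/
structure IsProper (P : SortingInstance n) (U : Finset (Fin n)) : Prop where
  lo_lt_hi : ∀ i ∈ U, P.lo i < P.hi i
  not_contains : ∀ i ∈ U, ∀ j ∈ U, ¬ (P.lo i < P.lo j ∧ P.hi j < P.hi i)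

theorem IsProper.mono {V : Finset (Fin n)} (hU : P.IsProper U) (hV : V ⊆ U) : P.IsProper V :=
  ⟨fun i hi => hU.lo_lt_hi i (hV hi), fun i hi j hj => hU.not_contains i (hV hi) j (hV hj)⟩

theorem mem_componentEnds {t : ℝ} : t ∈ P.componentEnds U ↔
    (∃ i ∈ U, P.hi i = t) ∧ ∀ j ∈ U, ¬ (P.lo j < t ∧ t < P.hi j) := by
  simp only [componentEnds, Finset.mem_image, Finset.mem_filter]
  constructor
  · rintro ⟨i, ⟨hi, h⟩, rfl⟩
    exact ⟨⟨i, hi, rfl⟩, h⟩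
  · rintro ⟨⟨i, hi, rfl⟩, h⟩
    exact ⟨i, ⟨hi, h⟩, rfl⟩

/-- Removing an interval with no right end of another one inside creates no component. -/
theorem componentEnds_erase_subset {w : Fin n}
    (h : ∀ i ∈ U, i ≠ w → ¬ (P.lo w < P.hi i ∧ P.hi i < P.hi w)) :
    P.componentEnds (U.erase w) ⊆ P.componentEnds U := by
  intro t ht
  rw [mem_componentEnds] at ht ⊢
  obtain ⟨⟨i, hi, rfl⟩, ht⟩ := ht
  rw [Finset.mem_erase] at hi
  refine ⟨⟨i, hi.2, rfl⟩, fun j hj => ?_⟩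
  by_cases hjw : j = w
  · subst hjw
    exact h i hi.2 hi.1
  · exact ht j (Finset.mem_erase.2 ⟨hjw, hj⟩)

/-- Removing any interval creates at most one new component: if there were two new right ends, the
interval of the larger one would be strictly inside the removed interval. -/
theorem card_componentEnds_erase_le (hU : P.IsProper U) {w : Fin n} (hw : w ∈ U) :
    (P.componentEnds (U.erase w)).card ≤ (P.componentEnds U).card + 1 := by
  have h1 : (P.componentEnds (U.erase w) \ P.componentEnds U).card ≤ 1 := by
    have hinside : ∀ t ∈ P.componentEnds (U.erase w) \ P.componentEnds U,
        P.lo w < t ∧ t < P.hi w := by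
      intro t ht
      rw [Finset.mem_sdiff, mem_componentEnds, mem_componentEnds] at ht
      obtain ⟨⟨⟨i, hi, rfl⟩, hcov⟩, hnot⟩ := ht
      by_contra hw'
      refine hnot ⟨⟨i, (Finset.mem_erase.1 hi).2, rfl⟩, fun j hj => ?_⟩
      by_cases hjw : j = w
      · exact hjw ▸ hw'
      · exact hcov j (Finset.mem_erase.2 ⟨hjw, hj⟩)
    have hlt : ∀ s ∈ P.componentEnds (U.erase w) \ P.componentEnds U,
        ∀ t ∈ P.componentEnds (U.erase w) \ P.componentEnds U, ¬ s < t := by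
      intro s hs t ht hst
      have hs' := hinside s hs
      have ht' := hinside t ht
      obtain ⟨j, hj, rfl⟩ := (mem_componentEnds.1 (Finset.mem_sdiff.1 ht).1).1
      have hcov := (mem_componentEnds.1 (Finset.mem_sdiff.1 hs).1).2 j hj
      refine hU.not_contains w hw j (Finset.mem_erase.1 hj).2 ⟨?_, ht'.2⟩
      by_contra! hle
      exact hcov ⟨by linarith, hst⟩
    rw [Finset.card_le_one]
    intro s hs t ht
    exact le_antisymm (not_lt.1 (hlt t ht s hs)) (not_lt.1 (hlt s hs t ht))
  have h2 := Finset.card_sdiff_add_card (P.componentEnds (U.erase w)) (P.componentEnds U)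
  have h3 := Finset.card_le_card
    (Finset.subset_union_left (s₁ := P.componentEnds (U.erase w)) (s₂ := P.componentEnds U))
  omega

/-- Removing a component that consists of two intervals removes its right end. -/
theorem card_componentEnds_erase_erase_lt (hU : P.IsProper U) {i j : Fin n} (hi : i ∈ U)
    (hj : j ∈ U)
    (hiU : ∀ w ∈ U, w ≠ i → w ≠ j → ¬ (P.lo w < P.hi i ∧ P.lo i < P.hi w))
    (hjU : ∀ w ∈ U, w ≠ i → w ≠ j → ¬ (P.lo w < P.hi j ∧ P.lo j < P.hi w)) :
    (P.componentEnds ((U.erase i).erase j)).card + 1 ≤ (P.componentEnds U).card := by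
  wlog hij : P.hi i ≤ P.hi j generalizing i j
  · rw [Finset.erase_right_comm]
    exact this hj hi (fun w hw h1 h2 => hjU w hw h2 h1) (fun w hw h1 h2 => hiU w hw h2 h1)
      (le_of_not_ge hij)
  have hlj := hU.lo_lt_hi j hj
  refine Finset.card_lt_card (Finset.ssubset_iff_of_subset ?_ |>.2 ⟨P.hi j, ?_, ?_⟩)
  · intro t ht
    rw [mem_componentEnds] at ht ⊢
    obtain ⟨⟨a, ha, rfl⟩, hcov⟩ := ht
    simp only [Finset.mem_erase] at ha
    have hla := hU.lo_lt_hi a ha.2.2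
    refine ⟨⟨a, ha.2.2, rfl⟩, fun w hw hwt => ?_⟩
    by_cases hwi : w = i
    · subst hwi
      exact hiU a ha.2.2 ha.2.1 ha.1 ⟨by linarith [hwt.2], hwt.1⟩
    by_cases hwj : w = j
    · subst hwj
      exact hjU a ha.2.2 ha.2.1 ha.1 ⟨by linarith [hwt.2], hwt.1⟩
    exact hcov w (Finset.mem_erase.2 ⟨hwj, Finset.mem_erase.2 ⟨hwi, hw⟩⟩) hwt
  · refine mem_componentEnds.2 ⟨⟨j, hj, rfl⟩, fun w hw hwt => ?_⟩
    by_cases hwi : w = i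
    · subst hwi
      linarith [hwt.2]
    by_cases hwj : w = j
    · subst hwj
      exact lt_irrefl _ hwt.2
    exact hjU w hw hwi hwj ⟨hwt.1, by linarith [hwt.2]⟩
  · intro hmem
    obtain ⟨⟨w, hw, hwj⟩, -⟩ := mem_componentEnds.1 hmem
    simp only [Finset.mem_erase] at hw
    have := hU.lo_lt_hi w hw.2.2
    exact hjU w hw.2.2 hw.2.1 hw.1 ⟨by linarith, by linarith⟩

/-! ### The items that are active after the preprocessing -/

open Classical in
/-- The non-isolated items of the current dependency graph. -/
noncomputable def nonisolated (P : SortingInstance n) (L : List (Fin n)) : Finset (Fin n) :=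
  Finset.univ.filter fun i => ∃ j, (P.depGraph L).Adj i j

theorem mem_nonisolated {i : Fin n} : i ∈ P.nonisolated L ↔ ∃ j, (P.depGraph L).Adj i j := by
  simp [nonisolated]

theorem notMem_of_mem_nonisolated (hδ : P.δ = 0) (hL : ∀ i, ¬ P.PreprocessGuard L i) {i : Fin n}
    (hi : i ∈ P.nonisolated L) : i ∉ L := by
  obtain ⟨j, hj⟩ := mem_nonisolated.1 hi
  exact notMem_of_adj hδ (fun i h => hL i (Or.inr h)) hj

theorem isProper_nonisolated (hδ : P.δ = 0) (hL : ∀ i, ¬ P.PreprocessGuard L i) :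
    P.IsProper (P.nonisolated L) := by
  have hcont : ∀ i ∉ L, ∀ j ∉ L, ¬ (P.lo i < P.lo j ∧ P.hi j < P.hi i) := by
    intro i hi j hj h
    refine hL i (Or.inl ⟨j, ?_⟩)
    simpa [StrictlyContains, hδ, curLo_of_notMem hi, curLo_of_notMem hj, curHi_of_notMem hi,
      curHi_of_notMem hj] using h
  refine ⟨fun i hi => ?_, fun i hi j hj => hcont i (notMem_of_mem_nonisolated hδ hL hi) j
    (notMem_of_mem_nonisolated hδ hL hj)⟩
  -- A degenerate interval is strictly inside every interval that depends on it.
  obtain ⟨j, hij⟩ := mem_nonisolated.1 hi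
  have hiL := notMem_of_mem_nonisolated hδ hL hi
  have hjL := notMem_of_mem_nonisolated hδ hL (mem_nonisolated.2 ⟨i, hij.symm⟩)
  by_contra! hle
  rw [depGraph_adj_iff_of_notMem hδ hiL hjL] at hij
  exact hcont j hjL i hiL ⟨by linarith, by linarith⟩

/-- Every item of `Q` has at most two neighbors outside `Q`: of three disjoint intervals that meet
a fourth one, the middle one is strictly inside the latter. -/
theorem card_nonisolated_le (hδ : P.δ = 0) (hL : ∀ i, ¬ P.PreprocessGuard L i)
    (hQ : P.ProvesOrder Q) : (P.nonisolated L).card ≤ 3 * Q.card := by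
  classical
  have hU := P.isProper_nonisolated hδ hL
  have hout : (P.nonisolated L \ Q).card ≤ 2 * Q.card := by
    have hex : ∀ i, ∃ j, i ∈ P.nonisolated L \ Q → (P.depGraph L).Adj i j := by
      intro i
      by_cases hi : i ∈ P.nonisolated L \ Q
      · obtain ⟨j, hj⟩ := mem_nonisolated.1 (Finset.mem_sdiff.1 hi).1
        exact ⟨j, fun _ => hj⟩
      · exact ⟨i, fun h => absurd h hi⟩
    choose f hf using hex
    refine Finset.card_le_mul_card_image_of_maps_to (f := f) (fun i hi => ?_) 2 fun w hw => ?_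
    · exact (hQ.mem_or_mem_of_adj hδ (hf i hi)).resolve_left (Finset.mem_sdiff.1 hi).2
    · by_contra! hlt
      obtain ⟨a, ha, b, hb, c, hc, hab, hac, hbc⟩ := Finset.two_lt_card.1 hlt
      rw [Finset.mem_filter] at ha hb hc
      have hadj : ∀ i, i ∈ P.nonisolated L \ Q ∧ f i = w →
          (P.lo i < P.hi i ∧ P.lo w < P.hi i ∧ P.lo i < P.hi w) ∧
            ¬ (P.lo w < P.lo i ∧ P.hi i < P.hi w) := by
        rintro i ⟨hi, rfl⟩
        have hiU := (Finset.mem_sdiff.1 hi).1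
        have hwU := mem_nonisolated.2 ⟨i, (hf i hi).symm⟩
        have h := (depGraph_adj_iff_of_notMem hδ (notMem_of_mem_nonisolated hδ hL hiU)
          (notMem_of_mem_nonisolated hδ hL hwU)).1 (hf i hi)
        exact ⟨⟨hU.lo_lt_hi i hiU, h.2.1, h.2.2⟩, hU.not_contains _ hwU i hiU⟩
      have hdisj : ∀ i, i ∈ P.nonisolated L \ Q ∧ f i = w →
          ∀ j, j ∈ P.nonisolated L \ Q ∧ f j = w → i ≠ j →
            P.hi i ≤ P.lo j ∨ P.hi j ≤ P.lo i := by
        intro i hi j hj hij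
        by_contra! h
        rcases hQ.mem_or_mem_of_lt hδ hij h.1 h.2 with h | h
        · exact (Finset.mem_sdiff.1 hi.1).2 h
        · exact (Finset.mem_sdiff.1 hj.1).2 h
      obtain ⟨⟨ha1, ha2, ha3⟩, ha4⟩ := hadj a ha
      obtain ⟨⟨hb1, hb2, hb3⟩, hb4⟩ := hadj b hb
      obtain ⟨⟨hc1, hc2, hc3⟩, hc4⟩ := hadj c hc
      rcases hdisj a ha b hb hab with h1 | h1 <;> rcases hdisj a ha c hc hac with h2 | h2 <;>
        rcases hdisj b hb c hc hbc with h3 | h3 <;>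
        first
        | linarith
        | exact ha4 ⟨by linarith, by linarith⟩
        | exact hb4 ⟨by linarith, by linarith⟩
        | exact hc4 ⟨by linarith, by linarith⟩
  have h1 := Finset.card_sdiff_add_card_inter (P.nonisolated L) Q
  have h2 := Finset.card_le_card (Finset.inter_subset_right (s₁ := P.nonisolated L) (s₂ := Q))
  omega

/-- A right end that is not inside another interval bounds all right ends of its component of the
dependency graph. So distinct elements of `componentEnds` belong to distinct components. -/
theorem hi_le_of_reachable (hδ : P.δ = 0) (hL : ∀ i, ¬ P.PreprocessGuard L i) {i j : Fin n}
    (hi : ∀ w ∈ P.nonisolated L, ¬ (P.lo w < P.hi i ∧ P.hi i < P.hi w))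
    (hij : (P.depGraph L).Reachable i j) : P.hi j ≤ P.hi i := by
  rw [SimpleGraph.reachable_iff_reflTransGen] at hij
  induction hij with
  | refl => exact le_rfl
  | @tail a b _ hab ih =>
    have haU := mem_nonisolated.2 ⟨b, hab⟩
    have hbU := mem_nonisolated.2 ⟨a, hab.symm⟩
    rw [depGraph_adj_iff_of_notMem hδ (notMem_of_mem_nonisolated hδ hL haU)
      (notMem_of_mem_nonisolated hδ hL hbU)] at hab
    by_contra! hlt
    exact hi b hbU ⟨by linarith [hab.2.1], hlt⟩

theorem mul_card_componentEnds_le (hδ : P.δ = 0) {k : ℕ}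
    (hk : P.LargeComponentsAfterPreprocessing k) (hL : P.PreprocessingResult L) :
    k * (P.componentEnds (P.nonisolated L)).card ≤ (P.nonisolated L).card := by
  classical
  have hends : (P.componentEnds (P.nonisolated L)).card ≤
      ((P.nonisolated L).image (P.depGraph L).connectedComponentMk).card := by
    have hex : ∀ t : P.componentEnds (P.nonisolated L), ∃ i ∈ P.nonisolated L, P.hi i = t :=
      fun t => (mem_componentEnds.1 t.2).1
    choose g hg using hex
    refine Finset.card_le_card_of_injective (f := fun t =>
      ⟨(P.depGraph L).connectedComponentMk (g t), Finset.mem_image_of_mem _ (hg t).1⟩)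
      fun s t hst => Subtype.ext ?_
    have hr := SimpleGraph.ConnectedComponent.eq.1 (congrArg Subtype.val hst)
    have h1 := hi_le_of_reachable hδ hL.2
      (by rw [(hg s).2]; exact (mem_componentEnds.1 s.2).2) hr
    have h2 := hi_le_of_reachable hδ hL.2
      (by rw [(hg t).2]; exact (mem_componentEnds.1 t.2).2) hr.symm
    rw [(hg s).2, (hg t).2] at h1 h2
    exact le_antisymm h2 h1
  refine (Nat.mul_le_mul_left k hends).trans (Finset.mul_card_image_le_card _ k fun c hc => ?_)
  obtain ⟨i, hi, rfl⟩ := Finset.mem_image.1 hc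
  obtain ⟨j, hij⟩ := mem_nonisolated.1 hi
  have hnon : ((P.depGraph L).connectedComponentMk i).supp.Nontrivial :=
    ⟨i, rfl, j, SimpleGraph.ConnectedComponent.eq.2 hij.symm.reachable, hij.ne⟩
  refine (hk L hL _ hnon).trans ?_
  rw [← Set.ncard_coe_finset]
  refine Set.ncard_le_ncard (fun a ha => ?_) (Finset.finite_toSet _)
  rw [Finset.mem_coe, Finset.mem_filter, mem_nonisolated]
  refine ⟨?_, ha⟩
  obtain ⟨b, hb, hab⟩ := hnon.exists_ne a
  have hr : (P.depGraph L).Reachable a b :=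
    SimpleGraph.ConnectedComponent.eq.1 (ha.trans hb.symm)
  obtain ⟨w⟩ := hr
  cases w with
  | nil => exact absurd rfl hab
  | cons h _ => exact ⟨_, h⟩

/-! ### The amortized bound on the number of queries -/

/-- The bookkeeping in the main loop and in the inner loop: `U` is a set of unqueried items outside
of which all unqueried items are isolated. Twice the number of queries plus the number of components
of `U` is bounded by three times the part of `Q` outside `U`, up to the constant `m`. -/
structure Balanced (P : SortingInstance n) (Q : Finset (Fin n)) (m : ℕ) (L : List (Fin n))
    (U : Finset (Fin n)) : Prop where
  isProper : P.IsProper U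
  notMem : ∀ i ∈ U, i ∉ L
  mem_or_mem : ∀ i j, (P.depGraph L).Adj i j → i ∈ U ∨ i ∈ L
  bound : 2 * L.length + (P.componentEnds U).card ≤ 3 * (Q \ U).card + m

variable {m : ℕ}

theorem Balanced.mem_of_adj (hδ : P.δ = 0) (hB : P.Balanced Q m L U)
    (hL : ∀ i, ¬ P.CleanupGuard L i) {i j : Fin n} (h : (P.depGraph L).Adj i j) : i ∈ U :=
  (hB.mem_or_mem i j h).resolve_right (notMem_of_adj hδ hL h)

theorem Balanced.adj_iff (hδ : P.δ = 0) (hB : P.Balanced Q m L U) {i j : Fin n} (hi : i ∈ U)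
    (hj : j ∈ U) : (P.depGraph L).Adj i j ↔ i ≠ j ∧ P.lo j < P.hi i ∧ P.lo i < P.hi j :=
  depGraph_adj_iff_of_notMem hδ (hB.notMem i hi) (hB.notMem j hj)

/-- The set `S` may be retired from `U` with the queries `q` inside `S` if the rest of `S` becomes
isolated and the queries are paid for by `Q ∩ S` and by the loss of components. -/
theorem Balanced.append (hδ : P.δ = 0) (hB : P.Balanced Q m L U) {S : Finset (Fin n)}
    {q : List (Fin n)} (hS : S ⊆ U) (hq : ∀ i ∈ q, i ∈ S)
    (hiso : ∀ i ∈ S, i ∉ q → ∀ j, ¬ (P.depGraph (L ++ q)).Adj i j)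
    (hcard : 2 * q.length + (P.componentEnds (U \ S)).card ≤
      3 * (Q ∩ S).card + (P.componentEnds U).card) :
    P.Balanced Q m (L ++ q) (U \ S) := by
  refine ⟨hB.isProper.mono Finset.sdiff_subset, fun i hi hiq => ?_, fun i j hij => ?_, ?_⟩
  · rw [Finset.mem_sdiff] at hi
    rcases List.mem_append.1 hiq with h | h
    · exact hB.notMem i hi.1 h
    · exact hi.2 (hq i h)
  · rcases hB.mem_or_mem i j (adj_of_adj_append hδ hij) with h | h
    · by_cases hiS : i ∈ S
      · by_cases hiq : i ∈ q
        · exact Or.inr (List.mem_append_right L hiq)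
        · exact absurd hij (hiso i hiS hiq j)
      · exact Or.inl (Finset.mem_sdiff.2 ⟨h, hiS⟩)
    · exact Or.inr (List.mem_append_left q h)
  · have hQ : (Q \ (U \ S)).card = (Q \ U).card + (Q ∩ S).card := by
      rw [← Finset.card_union_of_disjoint]
      · congr 1
        ext i
        have := @hS i
        simp only [Finset.mem_sdiff, Finset.mem_union, Finset.mem_inter]
        tauto
      · rw [Finset.disjoint_left]
        intro i hi hi'
        exact (Finset.mem_sdiff.1 hi).2 (hS (Finset.mem_inter.1 hi').2)
    have := hB.bound
    rw [List.length_append]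
    omega

/-- At the start of the main loop, only items of `Q` have been queried. -/
theorem balanced_nonisolated (hδ : P.δ = 0) (hL : ∀ i, ¬ P.PreprocessGuard L i) (hnd : L.Nodup)
    (hLQ : ∀ i ∈ L, i ∈ Q) :
    P.Balanced Q (P.componentEnds (P.nonisolated L)).card L (P.nonisolated L) := by
  refine ⟨P.isProper_nonisolated hδ hL, fun i => notMem_of_mem_nonisolated hδ hL,
    fun i j hij => Or.inl (mem_nonisolated.2 ⟨j, hij⟩), ?_⟩
  have : L.length ≤ (Q \ P.nonisolated L).card := by
    rw [← List.toFinset_card_of_nodup hnd]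
    refine Finset.card_le_card fun i hi => ?_
    rw [List.mem_toFinset] at hi
    exact Finset.mem_sdiff.2 ⟨hLQ i hi, fun h => notMem_of_mem_nonisolated hδ hL h hi⟩
  omega

theorem Balanced.cleanup (hδ : P.δ = 0) (hQ : P.ProvesOrder Q) (hB : P.Balanced Q m L U)
    {i : Fin n} (h : P.CleanupGuard L i) : P.Balanced Q m (L ++ [i]) (U \ {i}) := by
  have hiL := h.notMem hδ
  obtain ⟨j, hj, h1, h2⟩ := (cleanupGuard_iff hδ).1 h
  have hij : i ≠ j := fun e => hiL (e ▸ hj)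
  have hiU : i ∈ U := by
    refine (hB.mem_or_mem i j ?_).resolve_right hiL
    rw [depGraph_adj_iff hδ, curLo_of_mem hj, curHi_of_mem hj]
    exact ⟨hij, h2, h1⟩
  rw [curLo_of_notMem hiL] at h1
  rw [curHi_of_notMem hiL] at h2
  have hiQ := hQ.mem_of_val_mem_Ioo hδ hij.symm h1 h2
  refine hB.append hδ (by simpa using hiU) (by simp) (fun a ha hna => ?_) ?_
  · exact absurd (by simpa using ha) (by simpa using hna)
  · have := card_componentEnds_erase_le hB.isProper hiU
    rw [Finset.inter_singleton_of_mem hiQ, Finset.sdiff_singleton_eq_erase]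
    simp only [List.length_singleton, Finset.card_singleton]
    omega

theorem card_inter_pair_pos {i j : Fin n} (h : i ∈ Q ∨ j ∈ Q) : 1 ≤ (Q ∩ {i, j}).card := by
  rw [Nat.succ_le_iff, Finset.card_pos]
  rcases h with h | h
  · exact ⟨i, by simp [h]⟩
  · exact ⟨j, by simp [h]⟩

theorem two_le_card_inter_triple {x y z : Fin n} (hxy : x ≠ y) (hxz : x ≠ z) (hyz : y ≠ z)
    (h1 : x ∈ Q ∨ y ∈ Q) (h2 : x ∈ Q ∨ z ∈ Q) (h3 : y ∈ Q ∨ z ∈ Q) :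
    2 ≤ (Q ∩ {x, y, z}).card := by
  have key : ∀ a b, a ≠ b → a ∈ Q → b ∈ Q → a ∈ ({x, y, z} : Finset (Fin n)) →
      b ∈ ({x, y, z} : Finset (Fin n)) → 2 ≤ (Q ∩ {x, y, z}).card :=
    fun a b hab ha hb ha' hb' => Finset.one_lt_card.2
      ⟨a, Finset.mem_inter.2 ⟨ha, ha'⟩, b, Finset.mem_inter.2 ⟨hb, hb'⟩, hab⟩
  by_cases hx : x ∈ Q
  · rcases h3 with h | h
    · exact key x y hxy hx h (by simp) (by simp)
    · exact key x z hxz hx h (by simp) (by simp)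
  · exact key y z hyz (h1.resolve_left hx) (h2.resolve_left hx) (by simp) (by simp)

theorem IsEdgeComponent.adj {i j : Fin n} (h : P.IsEdgeComponent L i j) :
    (P.depGraph L).Adj i j := by
  rw [← SimpleGraph.mem_neighborSet, h.1]
  rfl

theorem Balanced.card_componentEnds_edge (hδ : P.δ = 0) (hB : P.Balanced Q m L U)
    {i j : Fin n} (h : P.IsEdgeComponent L i j) (hi : i ∈ U) (hj : j ∈ U) :
    (P.componentEnds (U \ {i, j})).card + 1 ≤ (P.componentEnds U).card := by
  have hset : U \ {i, j} = (U.erase i).erase j := by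
    ext a
    simp only [Finset.mem_sdiff, Finset.mem_erase, Finset.mem_insert, Finset.mem_singleton]
    tauto
  rw [hset]
  refine card_componentEnds_erase_erase_lt hB.isProper hi hj (fun w hw hwi hwj hlt => hwj ?_)
    fun w hw hwi hwj hlt => hwi ?_
  · have : w ∈ (P.depGraph L).neighborSet i := (hB.adj_iff hδ hi hw).2 ⟨hwi.symm, hlt⟩
    rwa [h.1] at this
  · have : w ∈ (P.depGraph L).neighborSet j := (hB.adj_iff hδ hj hw).2 ⟨hwj.symm, hlt⟩
    rwa [h.2] at this

/-! ### The choice of `x`, `y`, `z` -/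

/-- The facts about a valid choice of `x`, `y`, `z` that enter the analysis. -/
theorem IsTripleChoice.adj {x y z : Fin n} (h : P.IsTripleChoice L x y z) :
    (P.depGraph L).Adj x y ∧ x ≠ z ∧ y ≠ z ∧
      ((P.depGraph L).Adj x z ∨
        (P.depGraph L).neighborSet x = {y} ∧ (P.depGraph L).Adj y z) := by
  obtain ⟨-, hy, ⟨-, hz⟩ | ⟨hN, hz⟩⟩ := h
  · exact ⟨hy.1, (show (P.depGraph L).Adj x z from hz.1.1).ne, fun e => hz.1.2 e.symm,
      Or.inl hz.1.1⟩
  · exact ⟨hy.1, fun e => hz.1.2 e.symm, (show (P.depGraph L).Adj y z from hz.1.1).ne,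
      Or.inr ⟨hN, hz.1.1⟩⟩

/-- `x` and `y` have the smallest right ends of their component, so removing them creates no new
component. -/
theorem Balanced.componentEnds_pair (hδ : P.δ = 0) (hB : P.Balanced Q m L U)
    (hL : ∀ i, ¬ P.CleanupGuard L i) {x y z : Fin n} (h : P.IsTripleChoice L x y z) :
    P.componentEnds ((U.erase x).erase y) ⊆ P.componentEnds U := by
  obtain ⟨hx, hy, -⟩ := h
  have hxy : (P.depGraph L).Adj x y := hy.1
  have hxU := hB.mem_of_adj hδ hL hxy
  have hyU := hB.mem_of_adj hδ hL hxy.symm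
  have hxL := hB.notMem x hxU
  have hyL := hB.notMem y hyU
  have hxmin : ∀ i ∈ U, ∀ j, (P.depGraph L).Adj i j → P.hi x ≤ P.hi i := fun i hi j hij => by
    simpa [curHi_of_notMem hxL, curHi_of_notMem (hB.notMem i hi)] using hx.2 i ⟨j, hij⟩
  have hymin : ∀ i ∈ U, (P.depGraph L).Adj x i → P.hi y ≤ P.hi i := fun i hi hij => by
    simpa [curHi_of_notMem hyL, curHi_of_notMem (hB.notMem i hi)] using hy.2 i hij
  have hlt := (hB.adj_iff hδ hxU hyU).1 hxy
  refine (componentEnds_erase_subset fun i hi hiy hlt' => ?_).trans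
    (componentEnds_erase_subset fun i hi hix hlt' => ?_)
  · rw [Finset.mem_erase] at hi
    have hli := hB.isProper.lo_lt_hi i hi.2
    have hiy' : (P.depGraph L).Adj i y :=
      (hB.adj_iff hδ hi.2 hyU).2 ⟨hiy, hlt'.1, by linarith⟩
    have hxi := hxmin i hi.2 y hiy'
    by_cases hadj : (P.depGraph L).Adj x i
    · linarith [hymin i hi.2 hadj]
    · rw [hB.adj_iff hδ hxU hi.2] at hadj
      have : P.hi x ≤ P.lo i := by
        by_contra! hc
        exact hadj ⟨hi.1.symm, hc, by linarith [hB.isProper.lo_lt_hi x hxU]⟩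
      exact hB.isProper.not_contains y hyU i hi.2 ⟨by linarith, hlt'.2⟩
  · have hli := hB.isProper.lo_lt_hi i hi
    have hix' : (P.depGraph L).Adj i x :=
      (hB.adj_iff hδ hi hxU).2 ⟨hix, hlt'.1, by linarith⟩
    linarith [hxmin i hi x hix']

/-- `x`, `y` and `z` have the smallest right ends of their component, so removing them creates no
new component. -/
theorem Balanced.componentEnds_triple (hδ : P.δ = 0) (hB : P.Balanced Q m L U)
    (hL : ∀ i, ¬ P.CleanupGuard L i) {x y z : Fin n} (h : P.IsTripleChoice L x y z) :
    P.componentEnds (((U.erase x).erase y).erase z) ⊆ P.componentEnds U := by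
  refine Finset.Subset.trans (componentEnds_erase_subset fun i hi hiz hlt' => ?_)
    (hB.componentEnds_pair hδ hL h)
  simp only [Finset.mem_erase] at hi
  obtain ⟨hiy, hix, hiU⟩ := hi
  obtain ⟨hx, hy, hz⟩ := h
  have hxy : (P.depGraph L).Adj x y := hy.1
  have hxU := hB.mem_of_adj hδ hL hxy
  have hyU := hB.mem_of_adj hδ hL hxy.symm
  have hli := hB.isProper.lo_lt_hi i hiU
  have hlx := hB.isProper.lo_lt_hi x hxU
  have hlt := (hB.adj_iff hδ hxU hyU).1 hxy
  have hxi : (∃ j, (P.depGraph L).Adj i j) → P.hi x ≤ P.hi i := fun hij => by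
    simpa [curHi_of_notMem (hB.notMem x hxU), curHi_of_notMem (hB.notMem i hiU)] using hx.2 i hij
  rcases hz with ⟨-, hz⟩ | ⟨-, hz⟩
  · have hxz : (P.depGraph L).Adj x z := hz.1.1
    have hzU := hB.mem_of_adj hδ hL hxz.symm
    have hltz := (hB.adj_iff hδ hxU hzU).1 hxz
    have hxi := hxi ⟨z, (hB.adj_iff hδ hiU hzU).2 ⟨hiz, hlt'.1, by linarith⟩⟩
    by_cases hadj : (P.depGraph L).Adj x i
    · have := hz.2 i ⟨hadj, hiy⟩
      rw [curHi_of_notMem (hB.notMem z hzU), curHi_of_notMem (hB.notMem i hiU)] at this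
      linarith
    · rw [hB.adj_iff hδ hxU hiU] at hadj
      have : P.hi x ≤ P.lo i := by
        by_contra! hc
        exact hadj ⟨hix.symm, hc, by linarith⟩
      exact hB.isProper.not_contains z hzU i hiU ⟨by linarith, hlt'.2⟩
  · have hyz : (P.depGraph L).Adj y z := hz.1.1
    have hzU := hB.mem_of_adj hδ hL hyz.symm
    have hltz := (hB.adj_iff hδ hyU hzU).1 hyz
    have hxi := hxi ⟨z, (hB.adj_iff hδ hiU hzU).2 ⟨hiz, hlt'.1, by linarith⟩⟩
    by_cases hadj : (P.depGraph L).Adj y i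
    · have := hz.2 i ⟨hadj, hix⟩
      rw [curHi_of_notMem (hB.notMem z hzU), curHi_of_notMem (hB.notMem i hiU)] at this
      linarith
    · rw [hB.adj_iff hδ hyU hiU] at hadj
      have : P.hi y ≤ P.lo i := by
        by_contra! hc
        exact hadj ⟨hiy.symm, hc, by linarith⟩
      exact hB.isProper.not_contains z hzU i hiU ⟨by linarith, hlt'.2⟩

/-- Two neighbors of an item with minimum right end are dependent. -/
theorem IsMinRight.adj_of_adj_of_adj (hδ : P.δ = 0) {x y z : Fin n}
    (hx : P.IsMinRight L {u | ∃ w, (P.depGraph L).Adj u w} x) (hxy : (P.depGraph L).Adj x y)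
    (hxz : (P.depGraph L).Adj x z) (hyz : y ≠ z) : (P.depGraph L).Adj y z := by
  have h1 := hx.2 y ⟨x, hxy.symm⟩
  have h2 := hx.2 z ⟨x, hxz.symm⟩
  rw [depGraph_adj_iff hδ] at hxy hxz ⊢
  exact ⟨hyz, by linarith [hxz.2.1], by linarith [hxy.2.1]⟩

/-- In the absence of single-edge components, a dependency allows a choice of `x`, `y`, `z`. -/
theorem exists_isTripleChoice (hno : ∀ i j, ¬ P.IsEdgeComponent L i j)
    (hdep : ∃ i j, (P.depGraph L).Adj i j) : ∃ x y z, P.IsTripleChoice L x y z := by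
  have hmin : ∀ S : Set (Fin n), S.Nonempty → ∃ x, P.IsMinRight L S x := fun S hS => by
    obtain ⟨x, hx, h⟩ := Set.exists_min_image S (P.curHi L) S.toFinite hS
    exact ⟨x, hx, h⟩
  obtain ⟨x, hx⟩ := hmin {u | ∃ w, (P.depGraph L).Adj u w} hdep
  obtain ⟨y, hy⟩ := hmin ((P.depGraph L).neighborSet x) hx.1
  have hxy : (P.depGraph L).Adj x y := hy.1
  by_cases hN : (P.depGraph L).neighborSet x = {y}
  · obtain ⟨z, hz⟩ := hmin ((P.depGraph L).neighborSet y \ {x}) (by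
      by_contra hne
      rw [Set.not_nonempty_iff_eq_empty, Set.sdiff_eq_empty] at hne
      refine hno x y ⟨hN, hne.antisymm ?_⟩
      rintro _ rfl
      exact hxy.symm)
    exact ⟨x, y, z, hx, hy, Or.inr ⟨hN, hz⟩⟩
  · obtain ⟨z, hz⟩ := hmin ((P.depGraph L).neighborSet x \ {y}) (by
      by_contra hne
      rw [Set.not_nonempty_iff_eq_empty, Set.sdiff_eq_empty] at hne
      refine hN (hne.antisymm ?_)
      rintro _ rfl
      exact hxy)
    exact ⟨x, y, z, hx, hy, Or.inl ⟨hN, hz⟩⟩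

/-! ### The main loop -/

theorem Balanced.body (hδ : P.δ = 0) (hQ : P.ProvesOrder Q) (hB : P.Balanced Q m L U)
    (hL : ∀ i, ¬ P.CleanupGuard L i) {L' : List (Fin n)} (h : P.Body L L') :
    ∃ V, P.Balanced Q m L' V := by
  cases h with
  | edge_one i j hij h =>
    have hadj := hij.adj
    have hi := hB.mem_of_adj hδ hL hadj
    have hj := hB.mem_of_adj hδ hL hadj.symm
    have hends := hB.card_componentEnds_edge hδ hij hi hj
    have hpos := card_inter_pair_pos (hQ.mem_or_mem_of_adj hδ hadj)
    refine ⟨U \ {i, j}, hB.append hδ (by simp [Finset.insert_subset_iff, hi, hj]) (by simp)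
      (fun a ha hai b hab => ?_) (by simp only [List.length_singleton]; omega)⟩
    have haj : a = j := by simpa [List.mem_singleton.not.1 hai] using ha
    subst haj
    have hb : b ∈ (P.depGraph L).neighborSet a := adj_of_adj_append hδ hab
    rw [hij.2, Set.mem_singleton_iff] at hb
    subst hb
    exact h (strictlyContains_of_adj hδ hab (by simp))
  | edge_two i j hij h =>
    have hadj := hij.adj
    have hi := hB.mem_of_adj hδ hL hadj
    have hj := hB.mem_of_adj hδ hL hadj.symm
    have hends := hB.card_componentEnds_edge hδ hij hi hj
    have hpos := card_inter_pair_pos (hQ.mem_or_mem_of_adj hδ hadj)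
    refine ⟨U \ {i, j}, hB.append hδ (by simp [Finset.insert_subset_iff, hi, hj]) (by simp)
      (fun a ha hai => absurd ha (by simpa using hai)) ?_⟩
    simp only [List.length_cons, List.length_nil]
    omega
  | triple_one x y z hno hxyz h =>
    obtain ⟨hxy, hxz, hyz, hadj⟩ := hxyz.adj
    have hx := hB.mem_of_adj hδ hL hxy
    have hy := hB.mem_of_adj hδ hL hxy.symm
    have hends := Finset.card_le_card (hB.componentEnds_pair hδ hL hxyz)
    have hpos := card_inter_pair_pos (hQ.mem_or_mem_of_adj hδ hxy)
    have hset : U \ {x, y} = (U.erase x).erase y := by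
      ext a
      simp only [Finset.mem_sdiff, Finset.mem_erase, Finset.mem_insert, Finset.mem_singleton]
      tauto
    rw [← hset] at hends
    refine ⟨U \ {x, y}, hB.append hδ (by simp [Finset.insert_subset_iff, hx, hy]) (by simp)
      (fun a ha hay b hab => ?_) (by simp only [List.length_singleton]; omega)⟩
    have hax : a = x := by simpa [List.mem_singleton.not.1 hay] using ha
    subst hax
    rw [not_or] at h
    rcases hadj with hadj | ⟨hN, -⟩
    · -- Querying `y` leaves the intervals of `x` and `z` unchanged.
      have hz := hB.mem_of_adj hδ hL hadj.symm
      refine h.2 ((depGraph_adj_iff_of_notMem hδ ?_ ?_).2 ((hB.adj_iff hδ hx hz).1 hadj))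
      · simp [hB.notMem a hx, hxy.ne]
      · simp [hB.notMem z hz, hyz.symm]
    · have hb : b ∈ (P.depGraph L).neighborSet a := adj_of_adj_append hδ hab
      rw [hN, Set.mem_singleton_iff] at hb
      subst hb
      exact h.1 (strictlyContains_of_adj hδ hab (by simp))
  | triple_three x y z hno hxyz h =>
    obtain ⟨hxy, hxz, hyz, hadj⟩ := hxyz.adj
    have hx := hB.mem_of_adj hδ hL hxy
    have hy := hB.mem_of_adj hδ hL hxy.symm
    have hyz' : (P.depGraph L).Adj y z := by
      rcases hadj with hadj | hadj
      · exact hxyz.1.adj_of_adj_of_adj hδ hxy hadj hyz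
      · exact hadj.2
    have hz := hB.mem_of_adj hδ hL hyz'.symm
    have hends := Finset.card_le_card (hB.componentEnds_triple hδ hL hxyz)
    have hset : U \ {x, y, z} = ((U.erase x).erase y).erase z := by
      ext a
      simp only [Finset.mem_sdiff, Finset.mem_erase, Finset.mem_insert, Finset.mem_singleton]
      tauto
    rw [← hset] at hends
    -- If `x` and `z` are not dependent, then `x` is in `Q` because of the value of `y`.
    have hxzQ : x ∈ Q ∨ z ∈ Q := by
      rcases hadj with hadj | ⟨hN, -⟩
      · exact hQ.mem_or_mem_of_adj hδ hadj
      · rcases h with h | h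
        · have hxy' : x ∉ L ++ [y] := by simp [hB.notMem x hx, hxy.ne]
          rw [StrictlyContains, hδ, curLo_of_notMem hxy', curHi_of_notMem hxy', sub_zero,
            add_zero] at h
          exact Or.inl (hQ.mem_of_val_mem_Ioo hδ hxy.ne' h.1 h.2)
        · have hz : z ∈ (P.depGraph L).neighborSet x := adj_of_adj_append hδ h
          rw [hN] at hz
          exact absurd hz.symm hyz
    have htwo := two_le_card_inter_triple hxy.ne hxz hyz (hQ.mem_or_mem_of_adj hδ hxy) hxzQ
      (hQ.mem_or_mem_of_adj hδ hyz')
    refine ⟨U \ {x, y, z}, hB.append hδ (by simp [Finset.insert_subset_iff, hx, hy, hz])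
      (by simp) (fun a ha hna => absurd ha ?_) ?_⟩
    · simp only [List.mem_cons, List.not_mem_nil, or_false] at hna
      simp only [Finset.mem_insert, Finset.mem_singleton]
      tauto
    · simp only [List.length_cons, List.length_nil]
      omega

theorem Body.nodup (hδ : P.δ = 0) (hL : ∀ i, ¬ P.CleanupGuard L i) (hnd : L.Nodup)
    {L' : List (Fin n)} (h : P.Body L L') : L'.Nodup ∧ L.length < L'.length := by
  cases h with
  | edge_one i j hij h =>
    have hi := notMem_of_adj hδ hL hij.adj
    refine ⟨?_, by simp⟩
    simp [List.nodup_append, hnd]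
    grind
  | edge_two i j hij h =>
    have hi := notMem_of_adj hδ hL hij.adj
    have hj := notMem_of_adj hδ hL hij.adj.symm
    have hne := hij.adj.ne
    refine ⟨?_, by simp⟩
    simp [List.nodup_append, hnd]
    grind
  | triple_one x y z hno hxyz h =>
    have hy := notMem_of_adj hδ hL hxyz.adj.1.symm
    refine ⟨?_, by simp⟩
    simp [List.nodup_append, hnd]
    grind
  | triple_three x y z hno hxyz h =>
    obtain ⟨hxy, hxz, hyz, hadj⟩ := hxyz.adj
    have hx := notMem_of_adj hδ hL hxy
    have hy := notMem_of_adj hδ hL hxy.symm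
    have hz : z ∉ L := by
      rcases hadj with hadj | hadj
      · exact notMem_of_adj hδ hL hadj.symm
      · exact notMem_of_adj hδ hL hadj.2.symm
    have hne := hxy.ne
    refine ⟨?_, by simp⟩
    simp [List.nodup_append, hnd]
    grind

/-! ### Termination -/

/-- No item has been queried twice, and at the head of the main loop the inner loop has no query
left to make. -/
def NoRepeat (P : SortingInstance n) : Phase × List (Fin n) → Prop
  | (Phase.main, L) => L.Nodup ∧ ∀ i, ¬ P.CleanupGuard L i
  | (_, L) => L.Nodup

theorem NoRepeat.nodup {s : Phase × List (Fin n)} (h : P.NoRepeat s) : s.2.Nodup := by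
  rcases s with ⟨_ | _ | _ | _, L⟩
  exacts [h, h.1, h, h]

/-- A quantity that increases in every step. -/
def progress : Phase × List (Fin n) → ℕ
  | (Phase.preprocessing, L) => 2 * L.length
  | (Phase.main, L) => 2 * L.length + 1
  | (Phase.cleanup, L) => 2 * L.length
  | (Phase.done, L) => 2 * L.length + 2

theorem NoRepeat.step (hδ : P.δ = 0) {s t : Phase × List (Fin n)} (hs : P.NoRepeat s)
    (h : P.Step s t) : P.NoRepeat t ∧ progress s < progress t := by
  have happ : ∀ (L : List (Fin n)) (i : Fin n), L.Nodup → i ∉ L → (L ++ [i]).Nodup := by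
    intro L i hL hi
    simp [List.nodup_append, hL]
    grind
  cases h with
  | preprocess_query L i h =>
    exact ⟨happ L i hs (h.exists_val_mem hδ).1, by simp [progress]⟩
  | preprocess_exit L h => exact ⟨⟨hs, fun i hi => h i (Or.inr hi)⟩, by simp [progress]⟩
  | main_body L L' hdep h =>
    obtain ⟨h1, h2⟩ := h.nodup hδ hs.2 hs.1
    refine ⟨h1, ?_⟩
    simp only [progress]
    omega
  | main_exit L hdep => exact ⟨hs.1, by simp [progress]⟩
  | cleanup_query L i h => exact ⟨happ L i hs (h.notMem hδ), by simp [progress]⟩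
  | cleanup_exit L h => exact ⟨⟨hs, h⟩, by simp [progress]⟩

theorem not_forall_step (hδ : P.δ = 0) (f : ℕ → Phase × List (Fin n))
    (h0 : f 0 = (Phase.preprocessing, [])) : ¬ ∀ m, P.Step (f m) (f (m + 1)) := by
  intro hstep
  have key : ∀ m, P.NoRepeat (f m) ∧ m ≤ progress (f m) := by
    intro m
    induction m with
    | zero => exact ⟨by rw [h0]; exact List.nodup_nil, Nat.zero_le _⟩
    | succ m ih =>
      obtain ⟨h1, h2⟩ := ih.1.step hδ (hstep m)
      exact ⟨h1, by omega⟩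
  obtain ⟨h1, h2⟩ := key (2 * n + 3)
  have hlen : (f (2 * n + 3)).2.length ≤ n := by
    simpa using h1.nodup.length_le_card
  have hle : ∀ s : Phase × List (Fin n), progress s ≤ 2 * s.2.length + 2 := by
    rintro ⟨_ | _ | _ | _, L⟩ <;> simp [progress]
  have := hle (f (2 * n + 3))
  omega

/-- The algorithm can only stop in the control state for termination. -/
theorem eq_done_of_forall_not_step {ph : Phase} (h : ∀ t, ¬ P.Step (ph, L) t) :
    ph = Phase.done := by
  cases ph with
  | done => rfl
  | preprocessing =>
    by_cases hg : ∃ i, P.PreprocessGuard L i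
    · exact absurd (Step.preprocess_query L _ hg.choose_spec) (h _)
    · exact absurd (Step.preprocess_exit L (not_exists.1 hg)) (h _)
  | cleanup =>
    by_cases hg : ∃ i, P.CleanupGuard L i
    · exact absurd (Step.cleanup_query L _ hg.choose_spec) (h _)
    · exact absurd (Step.cleanup_exit L (not_exists.1 hg)) (h _)
  | main =>
    by_cases hdep : ∃ i j, (P.depGraph L).Adj i j
    · refine absurd ?_ (not_exists.2 fun L' (hb : P.Body L L') =>
        h _ (Step.main_body L L' hdep hb))
      by_cases he : ∃ i j, P.IsEdgeComponent L i j
      · obtain ⟨i, j, hij⟩ := he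
        by_cases hc : P.StrictlyContains (L ++ [i]) j (P.val i - P.δ) (P.val i + P.δ)
        · exact ⟨_, Body.edge_two L i j hij hc⟩
        · exact ⟨_, Body.edge_one L i j hij hc⟩
      · have hno : ∀ i j, ¬ P.IsEdgeComponent L i j := fun i j hij => he ⟨i, j, hij⟩
        obtain ⟨x, y, z, hxyz⟩ := exists_isTripleChoice hno hdep
        by_cases hc : P.StrictlyContains (L ++ [y]) x (P.val y - P.δ) (P.val y + P.δ) ∨
            (P.depGraph (L ++ [y])).Adj x z
        · exact ⟨_, Body.triple_three L x y z hno hxyz hc⟩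
        · exact ⟨_, Body.triple_one L x y z hno hxyz hc⟩
    · exact absurd (Step.main_exit L hdep) (h _)

/-! ### The competitive ratio -/

/-- The invariant of the whole execution, relative to a query set `Q` and the component size `k`. -/
def Invariant (P : SortingInstance n) (Q : Finset (Fin n)) (k : ℕ) :
    Phase × List (Fin n) → Prop
  | (Phase.preprocessing, L) => ∀ i ∈ L, i ∈ Q
  | (Phase.main, L) => ∃ m U, k * m ≤ 3 * Q.card ∧ P.Balanced Q m L U
  | (Phase.cleanup, L) => ∃ m U, k * m ≤ 3 * Q.card ∧ P.Balanced Q m L U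
  | (Phase.done, L) => (¬ ∃ i j, (P.depGraph L).Adj i j) ∧
      ∃ m U, k * m ≤ 3 * Q.card ∧ P.Balanced Q m L U

theorem Reachable.invariant (hδ : P.δ = 0) {k : ℕ} (hk : P.LargeComponentsAfterPreprocessing k)
    (hQ : P.ProvesOrder Q) {s : Phase × List (Fin n)} (hs : P.Reachable s) :
    P.NoRepeat s ∧ P.Invariant Q k s := by
  induction hs with
  | refl => exact ⟨List.nodup_nil, by simp [Invariant]⟩
  | @tail s t hs hst ih =>
    obtain ⟨hnr, hinv⟩ := ih
    refine ⟨(hnr.step hδ hst).1, ?_⟩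
    cases hst with
    | preprocess_query L i h =>
      intro a ha
      rcases List.mem_append.1 ha with ha | ha
      · exact hinv a ha
      · rw [List.mem_singleton.1 ha]
        obtain ⟨-, j, hj, h1, h2⟩ := h.exists_val_mem hδ
        exact hQ.mem_of_val_mem_Ioo hδ hj h1 h2
    | preprocess_exit L h =>
      exact ⟨_, _, (mul_card_componentEnds_le hδ hk ⟨hs, h⟩).trans (card_nonisolated_le hδ h hQ),
        balanced_nonisolated hδ h hnr hinv⟩
    | main_body L L' hdep h =>
      obtain ⟨m, U, hm, hB⟩ := hinv
      obtain ⟨V, hV⟩ := hB.body hδ hQ hnr.2 h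
      exact ⟨m, V, hm, hV⟩
    | main_exit L hdep => exact ⟨hdep, hinv⟩
    | cleanup_query L i h =>
      obtain ⟨m, U, hm, hB⟩ := hinv
      exact ⟨m, _, hm, hB.cleanup hδ hQ h⟩
    | cleanup_exit L h => exact hinv

end SortingInstance

theorem mainTheorem3 :
    ∃ C : ℝ, 0 < C ∧ ∀ k : ℕ, 1 ≤ k → ∀ (n : ℕ) (P : SortingInstance n), P.δ = 0 →
      P.LargeComponentsAfterPreprocessing k →
        P.AlgorithmCompetitive (3 / 2 + C / (k : ℝ)) := by
  refine ⟨3 / 2, by norm_num, fun k hk n P hδ hlarge => ⟨P.not_forall_step hδ, ?_⟩⟩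
  intro ph L hreach hfinal
  obtain rfl := SortingInstance.eq_done_of_forall_not_step hfinal
  obtain ⟨Q₀, hQ₀⟩ := P.exists_isOptimalQuerySet
  have hdep := (hreach.invariant hδ hlarge hQ₀.1).2.1
  refine ⟨rfl, SortingInstance.provesOrder_of_forall_not_adj hδ hdep, fun Q hQ => ?_⟩
  obtain ⟨-, -, m, U, hm, hB⟩ := hreach.invariant hδ hlarge hQ.1
  have hsub : (Q \ U).card ≤ Q.card := Finset.card_le_card Finset.sdiff_subset
  have hlen : 2 * L.length ≤ 3 * Q.card + m := by
    have := hB.bound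
    omega
  have hlen' : 2 * (L.length : ℝ) ≤ 3 * Q.card + m := by exact_mod_cast hlen
  have hm' : (k : ℝ) * m ≤ 3 * Q.card := by exact_mod_cast hm
  have hk' : (0 : ℝ) < k := by exact_mod_cast hk
  have hmk : (m : ℝ) ≤ 3 * Q.card / k := by
    rw [le_div_iff₀ hk']
    linarith
  have hring : (3 / 2 + 3 / 2 / (k : ℝ)) * Q.card = (3 * Q.card + 3 * Q.card / k) / 2 := by
    ring
  rw [hring]
  linarith
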